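/- Let $\beta>2$, $\epsilon>0$, and let $d,p\ge 1$ be integers; put $s=\lfloor\beta\rfloor$ and $\delta=\beta-s$. Norms of functions on $[0,1]^d$ are $$\|g\|_{\mathcal C^k([0,1]^d,\mathbb R^p)}=\max_{1\le i\le p}\ \max_{|\gamma|\le k}\ \sup_{x\in[0,1]^d}|D^\gamma g_i(x)| .$$ Let $f\in\mathcal H^\beta_p([0,1]^d,H)$ for some $H>0$, that is, $f\in\mathcal C^s([0,1]^d,\mathbb R^p)$ with $\|f\|_{\mathcal C^s}\le H$ and $$\frac{|D^\gamma f_i(x)-D^\gamma f_i(y)|}{\min(1,\|x-y\|)^\delta}\le H\qquad\text{for all } |\gamma|=s,\ 1\le i\le p,\ x\ne y\in[0,1]^d .$$ A rational function $r:\mathbb R^d\to\mathbb R$ of degree $n$ is a quotient $r=P/Q$ of coprime real polynomials in $d$ variables (no common nonconstant divisor) with $P\neq 0$, $Q>0$ everywhere on $\mathbb R^d$, and $n=\max(\deg P,\deg Q)$, where $\deg$ denotes the total degree. Then there exist constants $c,C>0$ and, for every integer $N\ge1$, a map $R^N:\mathbb R^d\to\mathbb R^p$ each of whose $p$ components is a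 rational function of degree at most $C N^{d+\epsilon}$, such that $$\|f-R^N\|_{\mathcal C^1([0,1]^d,\mathbb R^p)}\le c\,N^{-(\beta-1)}\qquad\text{for all integers } N\ge 1 .$$ -/

import Mathlib

open scoped ENNReal

noncomputable section

namespace RatApprox

/-- The closed unit cube `[0,1]^d` in Euclidean space `ℝ^d`. -/
def cube (d : ℕ) : Set (EuclideanSpace ℝ (Fin d)) :=
  {x | ∀ i, x i ∈ Set.Icc (0 : ℝ) 1}

/-- The iterated partial derivative `∂_{l 0} ∂_{l 1} ⋯ ∂_{l (k-1)} g (x)` of order `k`, for a real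
function `g` on the cube (derivatives are taken within the cube, hence one-sided at its boundary).
For `g` of class `C^k` the order of the differentiations is irrelevant, so that, as `l` runs through
all index sequences of length `k`, this runs through all `D^γ g (x)` with `|γ| = k`. -/
def partialDeriv {d k : ℕ} (l : Fin k → Fin d) (g : EuclideanSpace ℝ (Fin d) → ℝ)
    (x : EuclideanSpace ℝ (Fin d)) : ℝ :=
  iteratedFDerivWithin ℝ k g (cube d) x (fun j => EuclideanSpace.single (l j) (1 : ℝ))

/-- The norm of `C^k([0,1]^d, ℝ^p)`: the maximum over the components `g_i` and over `|γ| ≤ k` of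
`sup_{x ∈ [0,1]^d} |D^γ g_i(x)|`, as an extended nonnegative real. -/
def ckNorm {d p : ℕ} (k : ℕ) (g : EuclideanSpace ℝ (Fin d) → EuclideanSpace ℝ (Fin p)) : ℝ≥0∞ :=
  ⨆ (i : Fin p) (j : ℕ) (_ : j ≤ k) (l : Fin j → Fin d) (x ∈ cube d),
    ENNReal.ofReal |partialDeriv l (fun y => g y i) x|

/-- The Hölder constant `[h]_δ = sup_{x ≠ y ∈ [0,1]^d} |h(x) - h(y)| / min(1, ‖x - y‖)^δ` of a real
function on the cube, as an extended nonnegative real. -/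
def holderConst {d : ℕ} (δ : ℝ) (h : EuclideanSpace ℝ (Fin d) → ℝ) : ℝ≥0∞ :=
  ⨆ (x ∈ cube d) (y ∈ cube d) (_ : x ≠ y),
    ENNReal.ofReal (|h x - h y| / (min 1 ‖x - y‖) ^ δ)

/-- The Hölder norm of order `β = s + δ`, `s = ⌊β⌋`: the maximum of the `C^s` norm and of the Hölder
constants `[D^γ f_i]_δ`, `|γ| = s`. -/
def holderNorm {d p : ℕ} (β : ℝ) (f : EuclideanSpace ℝ (Fin d) → EuclideanSpace ℝ (Fin p)) :
    ℝ≥0∞ :=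
  max (ckNorm ⌊β⌋₊ f)
    (⨆ (i : Fin p) (l : Fin ⌊β⌋₊ → Fin d),
      holderConst (β - ⌊β⌋₊) (partialDeriv l (fun y => f y i)))

/-- The Hölder ball `ℋ^β_p([0,1]^d, H)`. Functions on the cube are represented by functions on `ℝ^d`,
of which only the values on the cube are used. -/
def holderBall (d p : ℕ) (β H : ℝ) :
    Set (EuclideanSpace ℝ (Fin d) → EuclideanSpace ℝ (Fin p)) :=
  {f | ContDiffOn ℝ (⌊β⌋₊ : ℕ) f (cube d) ∧ holderNorm β f ≤ ENNReal.ofReal H}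

/-- `r : ℝ^d → ℝ` is a rational function of degree `n`: `r = P / Q` on `ℝ^d` for real polynomials
`P ≠ 0` and `Q > 0` (everywhere on `ℝ^d`) without a common nonconstant divisor and with
`max (deg P) (deg Q) = n`, where `deg` is the total degree. -/
def IsRationalOfDegree {d : ℕ} (r : EuclideanSpace ℝ (Fin d) → ℝ) (n : ℕ) : Prop :=
  ∃ P Q : MvPolynomial (Fin d) ℝ,
    P ≠ 0 ∧ (∀ x : EuclideanSpace ℝ (Fin d), 0 < MvPolynomial.eval (fun i => x i) Q) ∧
    IsRelPrime P Q ∧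
    (∀ x : EuclideanSpace ℝ (Fin d),
      r x = MvPolynomial.eval (fun i => x i) P / MvPolynomial.eval (fun i => x i) Q) ∧
    max P.totalDegree Q.totalDegree = n

end RatApprox

end

/-!
The approximants are weighted means of Taylor polynomials (a Shepard operator). For `a` in the grid
`(ℤ / N)^d ∩ [0,1]^d` let `T_a` be the Taylor polynomial of `f` at `a` of degree `s = ⌊β⌋`, and let
`w_a(x) = (1 + N² ‖x - a‖²)^(-r)`. Then `R^N = (∑ w_a T_a) / ∑ w_a` is a quotient of polynomials of
degree `O(N^d)` whose denominator is positive, after clearing the `(N + 1)^d` denominators.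

Since the weights are positive, `f - R^N = (∑ w_a (f - T_a)) / ∑ w_a` is a mean of the Taylor
errors, which are `O(‖x - a‖^β)`, and `O(‖x - a‖^(β-1))` for the first derivative
(`taylorAt_estimates`). Moreover `|∇ w_a| ≤ r N w_a`, so that differentiating the weights costs only
a factor `O(N)` (`weightedMean_estimates`). It remains to see that the mean of `‖x - a‖^τ` is
`O(N^(-τ))` for `τ = β` and `τ = β - 1`. This holds as soon as `r - τ / 2 ≥ d`, because the sums
`∑_a (1 + N² ‖x - a‖²)^(-d)` are dominated by `d`-fold products of the bounded sums
`∑_k 1 / (1 + (t - k)²)`, while the weight of the node nearest to `x` is bounded below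
(`sum_weight_mul_norm_rpow_le`).

That the derivative of `T_a` is the Taylor polynomial of the derivative rests on the symmetry of the
iterated derivatives within the cube (`iteratedFDerivWithin_update_const`). Finally, common factors
of numerator and denominator are cancelled, and a component that vanishes identically is replaced
by the small constant `N^(-(β-1))`, to have a nonzero numerator.
-/

namespace RatApprox

/-! ### Taylor's formula on convex sets -/

/-- Taylor's formula for a chain of functions on `[0,1]`, each the derivative of the preceding one:
if the last function oscillates by at most `M`, then so small is the remainder. -/
lemma abs_sub_taylor_le (s : ℕ) (φ : ℕ → ℝ → ℝ) (M : ℝ)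
    (hφ : ∀ k < s, ∀ t ∈ Set.Icc (0 : ℝ) 1,
      HasDerivWithinAt (φ k) (φ (k + 1) t) (Set.Icc 0 1) t)
    (hM : ∀ t ∈ Set.Icc (0 : ℝ) 1, |φ s t - φ s 0| ≤ M) :
    ∀ t ∈ Set.Icc (0 : ℝ) 1,
      |φ 0 t - ∑ k ∈ Finset.range (s + 1), φ k 0 * t ^ k / (k.factorial : ℝ)| ≤ M := by
  induction s generalizing φ with
  | zero => simpa using hM
  | succ s ih =>
    have h1 := ih (fun k => φ (k + 1)) (fun k hk => hφ (k + 1) (by omega)) hM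
    intro t ht
    set F : ℝ → ℝ := fun t =>
      φ 0 t - ∑ k ∈ Finset.range (s + 1 + 1), φ k 0 * t ^ k / (k.factorial : ℝ) with hF
    have hF' : ∀ x ∈ Set.Icc (0 : ℝ) 1, HasDerivWithinAt F
        (φ 1 x - ∑ k ∈ Finset.range (s + 1), φ (k + 1) 0 * x ^ k / (k.factorial : ℝ))
        (Set.Icc 0 1) x := by
      intro x hx
      refine (hφ 0 (by omega) x hx).sub ?_
      have hs : HasDerivWithinAt
          (fun t : ℝ => ∑ k ∈ Finset.range (s + 1 + 1), φ k 0 * t ^ k / (k.factorial : ℝ))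
          (∑ k ∈ Finset.range (s + 1 + 1),
            φ k 0 * ((k : ℝ) * x ^ (k - 1)) / (k.factorial : ℝ)) (Set.Icc 0 1) x := by
        refine HasDerivWithinAt.fun_sum fun k _ => ?_
        exact (((hasDerivAt_pow k x).const_mul (φ k 0)).div_const _).hasDerivWithinAt
      refine hs.congr_deriv ?_
      rw [Finset.sum_range_succ' _ (s + 1)]
      simp only [Nat.cast_zero, zero_mul, mul_zero, zero_div, add_zero]
      refine Finset.sum_congr rfl fun k _ => ?_
      rw [Nat.factorial_succ]
      have : (k.factorial : ℝ) ≠ 0 := by positivity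
      push_cast
      field_simp
    have h0 : F 0 = 0 := by
      simp [hF, Finset.sum_range_succ' _ (s + 1)]
    have hmv := (convex_Icc (0 : ℝ) 1).norm_image_sub_le_of_norm_hasDerivWithin_le
      (C := M) hF' (fun x hx => by simpa using h1 x hx) (Set.left_mem_Icc.2 zero_le_one) ht
    have hM0 : 0 ≤ M := (abs_nonneg _).trans (hM t ht)
    rw [h0, sub_zero, sub_zero, Real.norm_eq_abs, Real.norm_eq_abs, abs_of_nonneg ht.1] at hmv
    exact hmv.trans (mul_le_of_le_one_right hM0 ht.2)

lemma cons_const {E : Type*} {k : ℕ} (v : E) :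
    (Fin.cons v (fun _ : Fin k => v) : Fin (k + 1) → E) = fun _ => v := by
  ext i
  refine Fin.cases ?_ (fun _ => ?_) i <;> simp

section Taylor

variable {E : Type*} [NormedAddCommGroup E] [NormedSpace ℝ E]

/-- The derivative of `t ↦ D^k f (a + t v) m` is `D^(k+1) f (a + t v) (v, m)`. -/
lemma hasDerivWithinAt_iteratedFDerivWithin_line {S : Set E} (hS : Convex ℝ S)
    (hu : UniqueDiffOn ℝ S) {n : ℕ} {f : E → ℝ} (hf : ContDiffOn ℝ n f S) {a x : E} (ha : a ∈ S)
    (hx : x ∈ S) {k : ℕ} (hk : k < n) (m : Fin k → E) {t : ℝ} (ht : t ∈ Set.Icc (0 : ℝ) 1) :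
    HasDerivWithinAt (fun t : ℝ => iteratedFDerivWithin ℝ k f S (a + t • (x - a)) m)
      (iteratedFDerivWithin ℝ (k + 1) f S (a + t • (x - a)) (Fin.cons (x - a) m))
      (Set.Icc 0 1) t := by
  have hmaps : Set.MapsTo (fun t : ℝ => a + t • (x - a)) (Set.Icc 0 1) S :=
    fun t ht => hS.add_smul_sub_mem ha hx ht
  have h1 : HasFDerivWithinAt (iteratedFDerivWithin ℝ k f S)
      (fderivWithin ℝ (iteratedFDerivWithin ℝ k f S) S (a + t • (x - a))) S (a + t • (x - a)) :=
    (hf.differentiableOn_iteratedFDerivWithin (by exact_mod_cast hk) hu _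
      (hmaps ht)).hasFDerivWithinAt
  have h2 : HasDerivWithinAt (fun t : ℝ => a + t • (x - a)) (x - a) (Set.Icc 0 1) t := by
    simpa using (((hasDerivAt_id t).smul_const (x - a)).const_add a).hasDerivWithinAt
  have h3 := h1.comp_hasDerivWithinAt t h2 hmaps
  have h4 := (ContinuousMultilinearMap.apply ℝ (fun _ : Fin k => E) ℝ m).hasFDerivAt
    (x := iteratedFDerivWithin ℝ k f S (a + t • (x - a)))
  have h5 := h4.comp_hasDerivWithinAt t h3
  rw [iteratedFDerivWithin_succ_apply_left]
  simpa [Function.comp_def] using h5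

/-- Symmetry of the iterated derivative, for vectors all but one of which are equal: the position
of the exceptional vector does not matter. The one transposition needed at each step is the
symmetry of the second derivative. -/
lemma iteratedFDerivWithin_update_const {S : Set E} (hu : UniqueDiffOn ℝ S)
    (hcl : S ⊆ closure (interior S)) {f : E → ℝ} (v e : E) (n : ℕ)
    (hf : ContDiffOn ℝ (n + 1 : ℕ) f S) {x : E} (hx : x ∈ S) (j : Fin (n + 1)) :
    iteratedFDerivWithin ℝ (n + 1) f S x (Function.update (fun _ => v) j e) =
      iteratedFDerivWithin ℝ (n + 1) f S x (Function.update (fun _ => v) 0 e) := by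
  induction n generalizing x with
  | zero => rw [Fin.fin_one_eq_zero j]
  | succ n ih =>
    refine Fin.cases rfl (fun i => ?_) j
    have happ : ∀ (k : ℕ) (hk : k < n + 2) (m : Fin k → E) (w : E) {y : E} (_ : y ∈ S),
        iteratedFDerivWithin ℝ (k + 1) f S y (Fin.cons w m) =
          fderivWithin ℝ (fun y => iteratedFDerivWithin ℝ k f S y m) S y w := by
      intro k hk m w y hy
      have hd : DifferentiableWithinAt ℝ (iteratedFDerivWithin ℝ k f S) S y :=
        hf.differentiableOn_iteratedFDerivWithin (by exact_mod_cast hk) hu y hy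
      have := ((ContinuousMultilinearMap.apply ℝ (fun _ : Fin k => E) ℝ m).hasFDerivAt
        (x := iteratedFDerivWithin ℝ k f S y)).comp_hasFDerivWithinAt y hd.hasFDerivWithinAt
      have h2 : fderivWithin ℝ (fun y => iteratedFDerivWithin ℝ k f S y m) S y = _ :=
        this.fderivWithin (hu y hy)
      rw [iteratedFDerivWithin_succ_apply_left, h2]
      simp
    have hc : ∀ {k : ℕ} (i : Fin k), (Function.update (fun _ => v) i.succ e : Fin (k + 1) → E) =
        Fin.cons v (Function.update (fun _ => v) i e) := by
      intro k i
      rw [Fin.cons_update, cons_const]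
    have hc0 : ∀ {k : ℕ}, (Function.update (fun _ => v) 0 e : Fin (k + 1) → E) =
        Fin.cons e (fun _ => v) := by
      intro k
      rw [← cons_const v, Fin.update_cons_zero]
    rw [hc, happ (n + 1) (by omega) _ _ hx]
    -- the vectors behind the first one are rearranged under the derivative
    have h1 : fderivWithin ℝ (fun y => iteratedFDerivWithin ℝ (n + 1) f S y
          (Function.update (fun _ => v) i e)) S x =
        fderivWithin ℝ (fun y => iteratedFDerivWithin ℝ (n + 1) f S y
          (Function.update (fun _ => v) 0 e)) S x :=
      fderivWithin_congr (fun y hy => ih (hf.of_le (by exact_mod_cast Nat.le_succ _)) hy i)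
        (ih (hf.of_le (by exact_mod_cast Nat.le_succ _)) hx i)
    rw [h1, hc0, hc0, ← cons_const v]
    -- the first two vectors are exchanged by the symmetry of the second derivative
    set h : E → ℝ := fun y => iteratedFDerivWithin ℝ n f S y (fun _ => v) with hh
    have hC2 : ContDiffOn ℝ 2 h S := by
      have : ContDiffOn ℝ 2 (iteratedFDerivWithin ℝ n f S) S := fun y hy =>
        (hf y hy).iteratedFDerivWithin_right hu (by norm_cast; omega) hy
      exact (ContinuousMultilinearMap.apply ℝ (fun _ : Fin n => E) ℝ
        (fun _ => v)).contDiff.comp_contDiffOn this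
    have hfd : DifferentiableWithinAt ℝ (fderivWithin ℝ h S) S x :=
      (hC2.fderivWithin hu (m := 1) (by norm_num)).differentiableOn (by norm_num) x hx
    have hs : ∀ w₁ w₂ : E, fderivWithin ℝ (fun y => iteratedFDerivWithin ℝ (n + 1) f S y
        (Fin.cons w₂ (fun _ => v))) S x w₁ =
        fderivWithin ℝ (fderivWithin ℝ h S) S x w₁ w₂ := by
      intro w₁ w₂
      have h2 : fderivWithin ℝ (fun y => iteratedFDerivWithin ℝ (n + 1) f S y
        (Fin.cons w₂ (fun _ => v))) S x = fderivWithin ℝ (fun y => fderivWithin ℝ h S y w₂) S x :=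
        fderivWithin_congr (fun y hy => happ n (by omega) _ _ hy) (happ n (by omega) _ _ hx)
      rw [h2, fderivWithin_clm_apply (hu x hx) hfd (differentiableWithinAt_const _)]
      simp
    rw [hs, happ (n + 1) (by omega) _ _ hx, hs]
    exact ((hC2 x hx).isSymmSndFDerivWithinAt (by simp) hu (hcl hx) hx) v e

/-- The Taylor polynomial of degree `n` of `f` at `a`, with derivatives taken within `S`. -/
noncomputable def taylorAt (f : E → ℝ) (S : Set E) (n : ℕ) (a x : E) : ℝ :=
  ∑ k ∈ Finset.range (n + 1),
    iteratedFDerivWithin ℝ k f S a (fun _ => x - a) / (k.factorial : ℝ)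

/-- The derivative of a Taylor polynomial is the Taylor polynomial of the derivative. -/
lemma hasFDerivAt_taylorAt {S : Set E} (hu : UniqueDiffOn ℝ S)
    (hcl : S ⊆ closure (interior S)) {f : E → ℝ} {n : ℕ} (hf : ContDiffOn ℝ (n + 1 : ℕ) f S)
    {a : E} (ha : a ∈ S) (x : E) :
    ∃ T' : E →L[ℝ] ℝ, HasFDerivAt (taylorAt f S (n + 1) a) T' x ∧
      ∀ e, T' e = ∑ k ∈ Finset.range (n + 1),
        iteratedFDerivWithin ℝ (k + 1) f S a (Fin.snoc (fun _ => x - a) e) /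
          (k.factorial : ℝ) := by
  have hk : ∀ k : ℕ, HasFDerivAt (fun y : E => iteratedFDerivWithin ℝ k f S a (fun _ => y - a))
      (∑ i : Fin k, ((iteratedFDerivWithin ℝ k f S a).toContinuousLinearMap
        (fun _ => x - a) i) ∘L (ContinuousLinearMap.id ℝ E)) x := fun k =>
    HasFDerivAt.multilinear_comp (iteratedFDerivWithin ℝ k f S a) (g := fun _ y => y - a)
      (fun _ => (hasFDerivAt_id x).sub_const a)
  refine ⟨_, HasFDerivAt.fun_sum fun k _ => ((hk k).mul_const ((k.factorial : ℝ)⁻¹)), fun e => ?_⟩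
  rw [Finset.sum_range_succ']
  simp only [Finset.univ_eq_empty, Finset.sum_empty, smul_zero, add_zero,
    sum_apply, smul_apply, ContinuousLinearMap.comp_apply,
    ContinuousLinearMap.id_apply, smul_eq_mul]
  refine Finset.sum_congr rfl fun k hkn => ?_
  have hfk : ContDiffOn ℝ (k + 1 : ℕ) f S :=
    hf.of_le (by have := Finset.mem_range.1 hkn; exact_mod_cast (by omega : k + 1 ≤ n + 1))
  have hlast : (Fin.snoc (fun _ => x - a) e : Fin (k + 1) → E) =
      Function.update (fun _ => x - a) (Fin.last k) e := by
    ext i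
    refine Fin.lastCases ?_ (fun i => ?_) i <;> simp [(Fin.castSucc_lt_last _).ne]
  have hsum : ∀ i : Fin (k + 1), ((iteratedFDerivWithin ℝ (k + 1) f S a).toContinuousLinearMap
      (fun _ => x - a) i) e =
      iteratedFDerivWithin ℝ (k + 1) f S a (Fin.snoc (fun _ => x - a) e) := by
    intro i
    rw [hlast, iteratedFDerivWithin_update_const hu hcl _ _ k hfk ha (Fin.last k),
      ← iteratedFDerivWithin_update_const hu hcl _ _ k hfk ha i]
    rfl
  rw [Finset.sum_congr rfl fun i _ => hsum i]
  rw [Finset.sum_const, Finset.card_univ, Fintype.card_fin, nsmul_eq_mul, Nat.factorial_succ]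
  have : (k.factorial : ℝ) ≠ 0 := by positivity
  push_cast
  field_simp

/-- Taylor's theorem with Hölder continuous derivatives of order `n + 1`, for the function and for
its first derivative. -/
lemma taylorAt_estimates {S : Set E} (hS : Convex ℝ S) (hu : UniqueDiffOn ℝ S)
    (hcl : S ⊆ closure (interior S)) {f : E → ℝ} {n : ℕ} (hf : ContDiffOn ℝ (n + 1 : ℕ) f S)
    {K δ : ℝ} (hK : 0 ≤ K) (hδ : 0 ≤ δ)
    (hH : ∀ x ∈ S, ∀ y ∈ S, ‖iteratedFDerivWithin ℝ (n + 1) f S x -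
      iteratedFDerivWithin ℝ (n + 1) f S y‖ ≤ K * ‖x - y‖ ^ δ)
    {a x : E} (ha : a ∈ S) (hx : x ∈ S) :
    |f x - taylorAt f S (n + 1) a x| ≤ K * ‖x - a‖ ^ (n + 1 + δ) ∧
    ∃ g' : E →L[ℝ] ℝ,
      HasFDerivWithinAt (fun y => f y - taylorAt f S (n + 1) a y) g' S x ∧
      ‖g'‖ ≤ K * ‖x - a‖ ^ (n + δ) := by
  set v := x - a with hv
  have hv0 : 0 ≤ ‖v‖ := norm_nonneg v
  have hosc : ∀ t ∈ Set.Icc (0 : ℝ) 1, ‖iteratedFDerivWithin ℝ (n + 1) f S (a + t • v) -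
      iteratedFDerivWithin ℝ (n + 1) f S a‖ ≤ K * ‖v‖ ^ δ := by
    intro t ht
    refine (hH _ (hS.add_smul_sub_mem ha hx ht) _ ha).trans ?_
    gcongr
    rw [add_sub_cancel_left, norm_smul, Real.norm_eq_abs, abs_of_nonneg ht.1]
    exact mul_le_of_le_one_left hv0 ht.2
  have hpow : ∀ k : ℕ, K * ‖v‖ ^ δ * ‖v‖ ^ k = K * ‖v‖ ^ (k + δ) := by
    intro k
    rw [mul_assoc, Real.rpow_add_of_nonneg hv0 (by positivity) hδ, Real.rpow_natCast,
      mul_comm (‖v‖ ^ δ)]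
  have h1 : (1 : ℝ) ∈ Set.Icc (0 : ℝ) 1 := by simp
  constructor
  · have := abs_sub_taylor_le (n + 1)
      (fun k t => iteratedFDerivWithin ℝ k f S (a + t • v) (fun _ => v)) (K * ‖v‖ ^ (n + 1 + δ))
      (fun k hk t ht => by
        have := hasDerivWithinAt_iteratedFDerivWithin_line hS hu hf ha hx hk (fun _ => v) ht
        rwa [cons_const] at this)
      (fun t ht => by
        have h2 := (iteratedFDerivWithin ℝ (n + 1) f S (a + t • v) -
          iteratedFDerivWithin ℝ (n + 1) f S a).le_of_opNorm_le (hosc t ht) (fun _ => v)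
        simp only [Finset.prod_const, Finset.card_univ, Fintype.card_fin, hpow] at h2
        simpa using h2) 1 h1
    simpa [taylorAt, hv] using this
  · obtain ⟨T', hT', hT'e⟩ := hasFDerivAt_taylorAt hu hcl hf ha x
    have hfd : HasFDerivWithinAt f (fderivWithin ℝ f S x) S x :=
      (hf.differentiableOn (by simp) x hx).hasFDerivWithinAt
    refine ⟨_, hfd.sub hT'.hasFDerivWithinAt, ?_⟩
    refine ContinuousLinearMap.opNorm_le_bound _ (by positivity) fun e => ?_
    have := abs_sub_taylor_le n
      (fun k t => iteratedFDerivWithin ℝ (k + 1) f S (a + t • v) (Fin.snoc (fun _ => v) e))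
      (K * ‖v‖ ^ (n + δ) * ‖e‖)
      (fun k hk t ht => by
        have := hasDerivWithinAt_iteratedFDerivWithin_line hS hu hf ha hx
          (Nat.succ_lt_succ hk) (Fin.snoc (fun _ => v) e) ht
        rwa [Fin.cons_snoc_eq_snoc_cons, cons_const] at this)
      (fun t ht => by
        have h2 := (iteratedFDerivWithin ℝ (n + 1) f S (a + t • v) -
          iteratedFDerivWithin ℝ (n + 1) f S a).le_of_opNorm_le (hosc t ht)
            (Fin.snoc (fun _ => v) e)
        simp only [Fin.prod_univ_castSucc, Fin.snoc_castSucc, Fin.snoc_last,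
          Finset.prod_const, Finset.card_univ, Fintype.card_fin, ← mul_assoc, hpow] at h2
        simpa using h2) 1 h1
    have h0 : iteratedFDerivWithin ℝ 1 f S x (Fin.snoc (fun _ => v) e) =
        fderivWithin ℝ f S x e := by
      rw [iteratedFDerivWithin_one_apply (hu x hx)]
      rfl
    simp only [hv, one_smul, add_sub_cancel] at this h0
    simpa [hT'e, ← h0] using this

end Taylor

/-! ### The cube and the Hölder ball -/

lemma convex_cube (d : ℕ) : Convex ℝ (cube d) := by
  intro x hx y hy a b ha hb hab i
  have := (convex_Icc (0 : ℝ) 1) (hx i) (hy i) ha hb hab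
  simpa using this

lemma interior_cube_nonempty (d : ℕ) : (interior (cube d)).Nonempty := by
  refine ⟨WithLp.toLp 2 fun _ => 1 / 2, ?_⟩
  have ho : IsOpen {x : EuclideanSpace ℝ (Fin d) | ∀ i, x i ∈ Set.Ioo (0 : ℝ) 1} := by
    simp only [Set.ofPred_forall]
    exact isOpen_iInter_of_finite fun i =>
      isOpen_Ioo.preimage (EuclideanSpace.proj (𝕜 := ℝ) i).continuous
  refine interior_maximal (t := {x : EuclideanSpace ℝ (Fin d) | ∀ i, x i ∈ Set.Ioo (0 : ℝ) 1})
    (fun x hx i => Set.Ioo_subset_Icc_self (hx i)) ho fun i => ?_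
  norm_num

lemma uniqueDiffOn_cube (d : ℕ) : UniqueDiffOn ℝ (cube d) :=
  uniqueDiffOn_convex (convex_cube d) (interior_cube_nonempty d)

lemma cube_subset_closure_interior (d : ℕ) : cube d ⊆ closure (interior (cube d)) := by
  rw [(convex_cube d).closure_interior_eq_closure_of_nonempty_interior (interior_cube_nonempty d)]
  exact subset_closure

lemma eq_sum_single {d : ℕ} (x : EuclideanSpace ℝ (Fin d)) :
    x = ∑ i, x i • EuclideanSpace.single i (1 : ℝ) := by
  ext j
  simp [Finset.sum_apply, Pi.single_apply]

lemma multilinear_apply_eq_sum {d k : ℕ}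
    (A : ContinuousMultilinearMap ℝ (fun _ : Fin k => EuclideanSpace ℝ (Fin d)) ℝ)
    (m : Fin k → EuclideanSpace ℝ (Fin d)) :
    A m = ∑ l : Fin k → Fin d,
      (∏ j, m j (l j)) * A (fun j => EuclideanSpace.single (l j) 1) := by
  conv_lhs => rw [show m = fun j => ∑ i, m j i • EuclideanSpace.single i (1 : ℝ) from
    funext fun j => eq_sum_single (m j)]
  rw [ContinuousMultilinearMap.map_sum]
  exact Finset.sum_congr rfl fun l _ => A.map_smul_univ _ _

/-- A multilinear form is bounded by its values on the standard basis. -/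
lemma opNorm_le_of_single {d k : ℕ}
    (A : ContinuousMultilinearMap ℝ (fun _ : Fin k => EuclideanSpace ℝ (Fin d)) ℝ) {M : ℝ}
    (hM : ∀ l : Fin k → Fin d, |A (fun j => EuclideanSpace.single (l j) 1)| ≤ M) (hM0 : 0 ≤ M) :
    ‖A‖ ≤ (d : ℝ) ^ k * M := by
  refine ContinuousMultilinearMap.opNorm_le_bound (by positivity) fun m => ?_
  rw [multilinear_apply_eq_sum]
  refine (norm_sum_le _ _).trans ?_
  calc ∑ l : Fin k → Fin d, ‖(∏ j, m j (l j)) * A (fun j => EuclideanSpace.single (l j) 1)‖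
      ≤ ∑ _l : Fin k → Fin d, (∏ j, ‖m j‖) * M := by
        refine Finset.sum_le_sum fun l _ => ?_
        rw [norm_mul, norm_prod]
        gcongr with j
        · exact PiLp.norm_apply_le (m j) (l j)
        · exact hM l
    _ = (d : ℝ) ^ k * M * ∏ j, ‖m j‖ := by
        simp; ring

/-- Hölder continuity of the top derivative, as a multilinear form, for the components of a
function in the Hölder ball. -/
lemma norm_iteratedFDerivWithin_sub_le {d p : ℕ} {β H : ℝ} (hβ : 0 ≤ β) (hH : 0 ≤ H)
    {f : EuclideanSpace ℝ (Fin d) → EuclideanSpace ℝ (Fin p)} (hf : f ∈ holderBall d p β H)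
    (i : Fin p) {x y : EuclideanSpace ℝ (Fin d)} (hx : x ∈ cube d) (hy : y ∈ cube d) :
    ‖iteratedFDerivWithin ℝ ⌊β⌋₊ (fun z => f z i) (cube d) x -
      iteratedFDerivWithin ℝ ⌊β⌋₊ (fun z => f z i) (cube d) y‖ ≤
      ((d : ℝ) ^ ⌊β⌋₊ * H) * ‖x - y‖ ^ (β - ⌊β⌋₊) := by
  have hδ : 0 ≤ β - ⌊β⌋₊ := sub_nonneg.2 (Nat.floor_le hβ)
  rw [mul_assoc]
  refine opNorm_le_of_single _ (fun l => ?_) (by positivity)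
  rcases eq_or_ne x y with rfl | hne
  · simp only [sub_self, zero_apply, abs_zero]
    positivity
  have hpos : 0 < min 1 ‖x - y‖ := lt_min one_pos (norm_pos_iff.2 (sub_ne_zero.2 hne))
  have h1 : ENNReal.ofReal (|partialDeriv l (fun z => f z i) x - partialDeriv l (fun z => f z i) y| /
      (min 1 ‖x - y‖) ^ (β - ⌊β⌋₊)) ≤ ENNReal.ofReal H := by
    refine le_trans ?_ ((le_max_right _ _).trans hf.2)
    refine le_trans ?_ (le_iSup₂_of_le i l le_rfl)
    unfold holderConst
    exact le_iSup₂_of_le x hx (le_iSup₂_of_le y hy (le_iSup_of_le hne le_rfl))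
  rw [ENNReal.ofReal_le_ofReal_iff hH, div_le_iff₀ (Real.rpow_pos_of_pos hpos _)] at h1
  refine h1.trans ?_
  gcongr
  exact min_le_right _ _

lemma contDiffOn_apply {d p : ℕ} {β H : ℝ}
    {f : EuclideanSpace ℝ (Fin d) → EuclideanSpace ℝ (Fin p)} (hf : f ∈ holderBall d p β H)
    (i : Fin p) : ContDiffOn ℝ (⌊β⌋₊ : ℕ) (fun z => f z i) (cube d) :=
  (EuclideanSpace.proj (𝕜 := ℝ) i).contDiff.comp_contDiffOn hf.1

/-- A bound for the `C¹` norm of a vector valued function, from bounds for the components. -/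
lemma ckNorm_one_le {d p : ℕ} {g : EuclideanSpace ℝ (Fin d) → EuclideanSpace ℝ (Fin p)} {M : ℝ}
    (hg : ∀ i, ∀ x ∈ cube d, |g x i| ≤ M ∧ ∃ g' : EuclideanSpace ℝ (Fin d) →L[ℝ] ℝ,
      HasFDerivWithinAt (fun y => g y i) g' (cube d) x ∧ ‖g'‖ ≤ M) :
    ckNorm 1 g ≤ ENNReal.ofReal M := by
  refine iSup₂_le fun i j => iSup₂_le fun hj l => iSup₂_le fun x hx => ?_
  refine ENNReal.ofReal_le_ofReal ?_
  obtain ⟨h0, g', hg', hle⟩ := hg i x hx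
  unfold partialDeriv
  interval_cases j
  · simpa using h0
  · rw [iteratedFDerivWithin_one_apply (uniqueDiffOn_cube d x hx),
      hg'.fderivWithin (uniqueDiffOn_cube d x hx), ← Real.norm_eq_abs]
    refine (g'.le_of_opNorm_le hle _).trans ?_
    simp

/-! ### Weighted means -/

/-- Weighted means of local approximants. If the derivative of every weight is at most `B` times
that weight, the errors `f - T a` and their derivatives are averaged, at the price of `2 B` times
the mean error in the derivative. -/
lemma weightedMean_estimates {E ι : Type*} [NormedAddCommGroup E] [NormedSpace ℝ E] [Fintype ι]
    [Nonempty ι] {S : Set E} {x : E} {f : E → ℝ} {w T : ι → E → ℝ} {w' g' : ι → E →L[ℝ] ℝ}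
    {B ε₀ ε₁ : ℝ} (hB : 0 ≤ B)
    (hw0 : ∀ a y, 0 < w a y) (hw : ∀ a, HasFDerivWithinAt (w a) (w' a) S x)
    (hw' : ∀ a, ‖w' a‖ ≤ B * w a x)
    (hT : ∀ a, HasFDerivWithinAt (fun y => f y - T a y) (g' a) S x)
    (h0 : ∑ a, w a x * |f x - T a x| ≤ ε₀ * ∑ a, w a x)
    (h1 : ∑ a, w a x * ‖g' a‖ ≤ ε₁ * ∑ a, w a x) :
    |f x - (∑ a, w a x * T a x) / ∑ a, w a x| ≤ ε₀ ∧
    ∃ G' : E →L[ℝ] ℝ,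
      HasFDerivWithinAt (fun y => f y - (∑ a, w a y * T a y) / ∑ a, w a y) G' S x ∧
      ‖G'‖ ≤ ε₁ + 2 * B * ε₀ := by
  have hW : ∀ y, 0 < ∑ a, w a y := fun y => Finset.sum_pos (fun a _ => hw0 a y) Finset.univ_nonempty
  have hWx := hW x
  have hrew : (fun y => f y - (∑ a, w a y * T a y) / ∑ a, w a y) =
      fun y => (∑ a, w a y * (f y - T a y)) * (∑ a, w a y)⁻¹ := by
    funext y
    have := (hW y).ne'
    simp only [mul_sub, Finset.sum_sub_distrib, ← Finset.sum_mul]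
    field_simp
  have hnum : |∑ a, w a x * (f x - T a x)| ≤ ε₀ * ∑ a, w a x := by
    refine (Finset.abs_sum_le_sum_abs _ _).trans (le_trans (le_of_eq ?_) h0)
    exact Finset.sum_congr rfl fun a _ => by rw [abs_mul, abs_of_pos (hw0 a x)]
  constructor
  · rw [show f x - (∑ a, w a x * T a x) / ∑ a, w a x = _ from congrFun hrew x, abs_mul, abs_inv,
      abs_of_pos hWx, ← div_eq_mul_inv, div_le_iff₀ hWx]
    exact hnum
  · rw [hrew]
    have hdn : HasFDerivWithinAt (fun y => ∑ a, w a y * (f y - T a y))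
        (∑ a, (w a x • g' a + (f x - T a x) • w' a)) S x :=
      HasFDerivWithinAt.fun_sum fun a _ => (hw a).mul (hT a)
    have hdW : HasFDerivWithinAt (fun y => ∑ a, w a y) (∑ a, w' a) S x :=
      HasFDerivWithinAt.fun_sum fun a _ => hw a
    have hdinv := (hasDerivAt_inv hWx.ne').comp_hasFDerivWithinAt x hdW
    refine ⟨_, hdn.mul hdinv, ?_⟩
    have e1 : ‖∑ a, (w a x • g' a + (f x - T a x) • w' a)‖ ≤ (ε₁ + B * ε₀) * ∑ a, w a x := by
      calc _ ≤ ∑ a, (w a x * ‖g' a‖ + B * (w a x * |f x - T a x|)) := by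
            refine norm_sum_le_of_le _ fun a _ => (norm_add_le _ _).trans ?_
            rw [norm_smul, norm_smul, Real.norm_eq_abs, Real.norm_eq_abs, abs_of_pos (hw0 a x)]
            have := mul_le_mul_of_nonneg_left (hw' a) (abs_nonneg (f x - T a x))
            linarith
        _ ≤ _ := by
            rw [Finset.sum_add_distrib, ← Finset.mul_sum]
            have := mul_le_mul_of_nonneg_left h0 hB
            linarith
    have e2 : ‖∑ a, w' a‖ ≤ B * ∑ a, w a x := by
      rw [Finset.mul_sum]
      exact norm_sum_le_of_le _ fun a _ => hw' a
    have hε₀ : 0 ≤ ε₀ := by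
      have := (abs_nonneg _).trans hnum
      exact nonneg_of_mul_nonneg_left this hWx
    set W := ∑ a, w a x with hWdef
    refine (norm_add_le _ _).trans ?_
    simp only [norm_smul, Real.norm_eq_abs, abs_neg, abs_inv,
      abs_pow, abs_of_pos hWx]
    have h2 : |∑ a, w a x * (f x - T a x)| * ((W ^ 2)⁻¹ * ‖∑ a, w' a‖) ≤
        (ε₀ * W) * ((W ^ 2)⁻¹ * (B * W)) := by gcongr
    have h3 : W⁻¹ * ‖∑ a, (w a x • g' a + (f x - T a x) • w' a)‖ ≤
        W⁻¹ * ((ε₁ + B * ε₀) * W) := by gcongr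
    have h4 : (ε₀ * W) * ((W ^ 2)⁻¹ * (B * W)) = B * ε₀ := by field_simp
    have h5 : W⁻¹ * ((ε₁ + B * ε₀) * W) = ε₁ + B * ε₀ := by field_simp
    linarith

/-! ### The weights -/

/-- The point of the grid `(ℤ / N)^d` with numerators `a`. -/
noncomputable def node {d : ℕ} (N : ℕ) (a : Fin d → Fin (N + 1)) : EuclideanSpace ℝ (Fin d) :=
  WithLp.toLp 2 fun j => (a j : ℝ) / N

lemma node_mem_cube {d N : ℕ} (a : Fin d → Fin (N + 1)) :
    node N a ∈ cube d := by
  intro j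
  refine ⟨by simp only [node]; positivity, ?_⟩
  refine div_le_one_of_le₀ ?_ (by positivity)
  exact_mod_cast Nat.lt_succ_iff.1 (a j).2

/-- The inverse of the weight, before taking the power `r`: `1 + N² ‖x - a / N‖²`. -/
noncomputable def bump {d : ℕ} (N : ℕ) (a : Fin d → Fin (N + 1)) (x : EuclideanSpace ℝ (Fin d)) :
    ℝ :=
  1 + (N : ℝ) ^ 2 * ‖x - node N a‖ ^ 2

lemma one_le_bump {d N : ℕ} (a : Fin d → Fin (N + 1)) (x : EuclideanSpace ℝ (Fin d)) :
    1 ≤ bump N a x :=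
  le_add_of_nonneg_right (by positivity)

lemma bump_eq {d N : ℕ} (hN : 1 ≤ N) (a : Fin d → Fin (N + 1)) (x : EuclideanSpace ℝ (Fin d)) :
    bump N a x = 1 + ∑ j, (N * x j - a j) ^ 2 := by
  have hN0 : (N : ℝ) ≠ 0 := by positivity
  rw [bump, EuclideanSpace.real_norm_sq_eq, Finset.mul_sum]
  congr 1
  refine Finset.sum_congr rfl fun j _ => ?_
  rw [← mul_pow]
  congr 1
  simp only [node, PiLp.sub_apply]
  field_simp

/-- The derivative of the weight `bump⁻ʳ` is at most `r N` times the weight. -/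
lemma hasFDerivAt_bump_pow_inv {d N : ℕ} (a : Fin d → Fin (N + 1)) (r : ℕ)
    (x : EuclideanSpace ℝ (Fin d)) :
    ∃ w' : EuclideanSpace ℝ (Fin d) →L[ℝ] ℝ,
      HasFDerivAt (fun y => (bump N a y ^ r)⁻¹) w' x ∧ ‖w'‖ ≤ r * N * (bump N a x ^ r)⁻¹ := by
  have hq : 0 < bump N a x := one_pos.trans_le (one_le_bump a x)
  have h1 : HasFDerivAt (bump N a)
      ((N : ℝ) ^ 2 • (2 • (innerSL ℝ (x - node N a)).comp
        (ContinuousLinearMap.id ℝ (EuclideanSpace ℝ (Fin d))))) x :=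
    (((hasFDerivAt_id x).sub_const (node N a)).norm_sq.const_mul _).const_add 1
  have h2 := (hasDerivAt_inv (pow_pos hq r).ne').comp_hasFDerivAt x
    ((hasDerivAt_pow r (bump N a x)).comp_hasFDerivAt x h1)
  refine ⟨_, h2, ?_⟩
  have h3 : ‖(N : ℝ) ^ 2 • (2 • (innerSL ℝ (x - node N a)).comp
        (ContinuousLinearMap.id ℝ (EuclideanSpace ℝ (Fin d))))‖ ≤ N * bump N a x := by
    rw [norm_smul, ContinuousLinearMap.comp_id, ← Nat.cast_smul_eq_nsmul ℝ, norm_smul,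
      innerSL_apply_norm, bump]
    simp only [norm_pow, RCLike.norm_natCast, Nat.cast_ofNat, Real.norm_ofNat]
    have : (0 : ℝ) ≤ N * (N * ‖x - node N a‖ - 1) ^ 2 := by positivity
    nlinarith
  rw [norm_smul, norm_smul, norm_neg, norm_inv, norm_mul, norm_pow, norm_pow, norm_pow,
    RCLike.norm_natCast, Real.norm_of_nonneg hq.le]
  set q := bump N a x
  rcases Nat.eq_zero_or_pos r with rfl | hr
  · simp
  calc _ ≤ ((q ^ r) ^ 2)⁻¹ * (r * q ^ (r - 1) * (N * q)) := by gcongr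
    _ = ((q ^ r) ^ 2)⁻¹ * (r * N * (q ^ (r - 1) * q)) := by ring
    _ = r * N * (q ^ r)⁻¹ := by
        rw [← pow_succ, Nat.sub_add_cancel hr]
        field_simp

/-- The sums `∑ₖ 1 / (1 + (t - k)²)` are bounded uniformly in `t`. -/
lemma exists_sum_inv_one_add_sq_le :
    ∃ A : ℝ, 0 < A ∧ ∀ (N : ℕ) (t : ℝ), ∑ k : Fin (N + 1), (1 + (t - (k : ℕ)) ^ 2)⁻¹ ≤ A := by
  set h : ℤ → ℝ := fun i => (1 + (i : ℝ) ^ 2)⁻¹ with hh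
  have hpos : ∀ i, 0 < h i := fun i => by simp only [hh]; positivity
  have hs : Summable h := by
    have h1 := ((Real.summable_one_div_int_add_rpow (1 / 2) 2).2 (by norm_num)).mul_left 2
    refine Summable.of_nonneg_of_le (fun i => (hpos i).le) (fun i => ?_) h1
    have h2 : (i : ℝ) + 1 / 2 ≠ 0 := by
      intro h0
      have : (2 * i + 1 : ℤ) = 0 := by
        have : ((2 * i + 1 : ℤ) : ℝ) = 0 := by push_cast; linarith
        exact_mod_cast this
      omega
    have h3 : (0 : ℝ) < ((i : ℝ) + 1 / 2) ^ 2 := by positivity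
    simp only [hh]
    rw [Real.rpow_two, sq_abs, mul_one_div, inv_eq_one_div,
      div_le_div_iff₀ (by positivity) h3]
    nlinarith [sq_nonneg ((i : ℝ) - 1 / 2)]
  refine ⟨2 * ∑' i, h i, by have := hs.tsum_pos (fun i => (hpos i).le) 0 (hpos 0); linarith,
    fun N t => ?_⟩
  have hshift : ∀ c : ℤ, ∑ k : Fin (N + 1), h ((k : ℕ) - c) ≤ ∑' i, h i := by
    intro c
    have hinj : Function.Injective fun k : Fin (N + 1) => (((k : ℕ) : ℤ) - c) :=
      fun k k' hk => by
        have : (k : ℕ) = (k' : ℕ) := by simpa using hk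
        exact Fin.ext this
    have := hs.sum_le_tsum (Finset.univ.image fun k : Fin (N + 1) => (((k : ℕ) : ℤ) - c))
      (fun i _ => (hpos i).le)
    rwa [Finset.sum_image fun k _ k' _ hk => hinj hk] at this
  have hterm : ∀ k : Fin (N + 1), (1 + (t - (k : ℕ)) ^ 2)⁻¹ ≤
      h ((k : ℕ) - ⌊t⌋) + h ((k : ℕ) - (⌊t⌋ + 1)) := by
    intro k
    have hf := Int.floor_le t
    have hf' := Int.lt_floor_add_one t
    -- compare `t` with the nearer of the integers `⌊t⌋` and `⌊t⌋ + 1`, as seen from `k`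
    rcases le_or_gt ((k : ℕ) : ℤ) ⌊t⌋ with hk | hk
    · refine le_add_of_le_of_nonneg ?_ (hpos _).le
      have hk' : ((k : ℕ) : ℝ) ≤ (⌊t⌋ : ℝ) := by exact_mod_cast hk
      simp only [hh]
      push_cast
      gcongr 1
      nlinarith
    · refine le_add_of_nonneg_of_le (hpos _).le ?_
      have hk' : (⌊t⌋ : ℝ) + 1 ≤ ((k : ℕ) : ℝ) := by exact_mod_cast hk
      simp only [hh]
      push_cast
      gcongr 1
      nlinarith
  refine (Finset.sum_le_sum fun k _ => hterm k).trans ?_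
  rw [Finset.sum_add_distrib]
  linarith [hshift ⌊t⌋, hshift (⌊t⌋ + 1)]

lemma sum_bump_pow_inv_le {d : ℕ} {A : ℝ}
    (hA : ∀ (N : ℕ) (t : ℝ), ∑ k : Fin (N + 1), (1 + (t - (k : ℕ)) ^ 2)⁻¹ ≤ A)
    {N : ℕ} (hN : 1 ≤ N) (x : EuclideanSpace ℝ (Fin d)) :
    ∑ a : Fin d → Fin (N + 1), (bump N a x ^ d)⁻¹ ≤ A ^ d := by
  calc ∑ a : Fin d → Fin (N + 1), (bump N a x ^ d)⁻¹
      ≤ ∑ a : Fin d → Fin (N + 1), ∏ j, (1 + (N * x j - (a j : ℕ)) ^ 2)⁻¹ := by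
        refine Finset.sum_le_sum fun a _ => ?_
        rw [Finset.prod_inv_distrib]
        refine inv_anti₀ (Finset.prod_pos fun j _ => by positivity) ?_
        have h : ∏ j, (1 + ((N : ℝ) * x j - (a j : ℕ)) ^ 2) ≤ ∏ _j : Fin d, bump N a x := by
          refine Finset.prod_le_prod (fun j _ => by positivity) fun j _ => ?_
          rw [bump_eq hN]
          gcongr
          exact Finset.single_le_sum (f := fun j => ((N : ℝ) * x j - (a j : ℕ)) ^ 2)
            (fun j _ => sq_nonneg _) (Finset.mem_univ j)
        simpa using h
    _ = ∏ j : Fin d, ∑ k : Fin (N + 1), (1 + (N * x j - (k : ℕ)) ^ 2)⁻¹ := by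
        rw [Finset.prod_univ_sum, Fintype.piFinset_univ]
    _ ≤ ∏ _j : Fin d, A :=
        Finset.prod_le_prod (fun j _ => Finset.sum_nonneg fun k _ => by positivity)
          fun j _ => hA N _
    _ = A ^ d := by simp

/-- The weights do not all degenerate: some node lies within `√d / N` of `x`. -/
lemma le_sum_bump_pow_inv {d N : ℕ} (hN : 1 ≤ N) (r : ℕ) {x : EuclideanSpace ℝ (Fin d)}
    (hx : x ∈ cube d) :
    ((1 + d : ℝ) ^ r)⁻¹ ≤ ∑ a : Fin d → Fin (N + 1), (bump N a x ^ r)⁻¹ := by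
  have hN0 : (0 : ℝ) < N := by positivity
  have hfl : ∀ j, ⌊(N : ℝ) * x j⌋₊ < N + 1 := fun j => by
    refine Nat.lt_succ_of_le (Nat.floor_le_of_le ?_)
    exact mul_le_of_le_one_right hN0.le (hx j).2
  set a : Fin d → Fin (N + 1) := fun j => ⟨⌊(N : ℝ) * x j⌋₊, hfl j⟩ with ha
  have hq : bump N a x ≤ 1 + d := by
    rw [bump_eq hN]
    have : ∑ j, ((N : ℝ) * x j - (a j : ℕ)) ^ 2 ≤ ∑ _j : Fin d, (1 : ℝ) := by
      refine Finset.sum_le_sum fun j _ => ?_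
      have h0 : 0 ≤ (N : ℝ) * x j := mul_nonneg hN0.le (hx j).1
      have h1 := Nat.floor_le h0
      have h2 := Nat.lt_floor_add_one ((N : ℝ) * x j)
      simp only [ha]
      nlinarith
    simpa using this
  have hq1 := one_le_bump a x
  calc ((1 + d : ℝ) ^ r)⁻¹ ≤ (bump N a x ^ r)⁻¹ := by gcongr
    _ ≤ _ := Finset.single_le_sum (f := fun a => (bump N a x ^ r)⁻¹)
        (fun b _ => by have := one_le_bump b x; positivity) (Finset.mem_univ a)

/-- The mean of `‖x - a / N‖^τ` over the nodes is `O(N^(-τ))`: the power `m` of the bump absorbs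
the factor `‖x - a / N‖^τ`, the remaining power `d` makes the sum converge. -/
lemma sum_weight_mul_norm_rpow_le {d m N : ℕ} {A τ : ℝ}
    (hA : ∀ (N : ℕ) (t : ℝ), ∑ k : Fin (N + 1), (1 + (t - (k : ℕ)) ^ 2)⁻¹ ≤ A) (hA0 : 0 < A)
    (hN : 1 ≤ N) (hτ0 : 0 ≤ τ) (hτ : τ ≤ 2 * m) {x : EuclideanSpace ℝ (Fin d)} (hx : x ∈ cube d) :
    ∑ a : Fin d → Fin (N + 1), (bump N a x ^ (m + d))⁻¹ * ‖x - node N a‖ ^ τ ≤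
      (A ^ d * (1 + d) ^ (m + d) * (N : ℝ) ^ (-τ)) *
        ∑ a : Fin d → Fin (N + 1), (bump N a x ^ (m + d))⁻¹ := by
  have hN0 : (0 : ℝ) < N := by positivity
  have hNτ : (0 : ℝ) < (N : ℝ) ^ (-τ) := Real.rpow_pos_of_pos hN0 _
  have hterm : ∀ a : Fin d → Fin (N + 1),
      (bump N a x ^ (m + d))⁻¹ * ‖x - node N a‖ ^ τ ≤ (N : ℝ) ^ (-τ) * (bump N a x ^ d)⁻¹ := by
    intro a
    have hq1 := one_le_bump a x
    have hu : (N : ℝ) * ‖x - node N a‖ ≤ bump N a x ^ (1 / 2 : ℝ) := by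
      rw [← Real.sqrt_eq_rpow]
      refine Real.le_sqrt_of_sq_le ?_
      rw [mul_pow, bump]
      linarith
    have h1 : (N : ℝ) ^ τ * ‖x - node N a‖ ^ τ ≤ bump N a x ^ m := by
      rw [← Real.mul_rpow hN0.le (norm_nonneg _)]
      refine (Real.rpow_le_rpow (by positivity) hu hτ0).trans ?_
      rw [← Real.rpow_mul (by positivity), ← Real.rpow_natCast]
      exact Real.rpow_le_rpow_of_exponent_le hq1 (by linarith)
    have h2 : ‖x - node N a‖ ^ τ ≤ (N : ℝ) ^ (-τ) * bump N a x ^ m := by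
      rw [Real.rpow_neg hN0.le, inv_mul_eq_div, le_div_iff₀ (Real.rpow_pos_of_pos hN0 _), mul_comm]
      exact h1
    calc _ ≤ (bump N a x ^ (m + d))⁻¹ * ((N : ℝ) ^ (-τ) * bump N a x ^ m) := by gcongr
      _ = _ := by
        rw [pow_add]
        field_simp
  calc _ ≤ ∑ a : Fin d → Fin (N + 1), (N : ℝ) ^ (-τ) * (bump N a x ^ d)⁻¹ :=
        Finset.sum_le_sum fun a _ => hterm a
    _ ≤ (N : ℝ) ^ (-τ) * A ^ d := by
        rw [← Finset.mul_sum]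
        gcongr
        exact sum_bump_pow_inv_le hA hN x
    _ = (A ^ d * (1 + d) ^ (m + d) * (N : ℝ) ^ (-τ)) * ((1 + d : ℝ) ^ (m + d))⁻¹ := by
        field_simp
    _ ≤ _ := by
        gcongr
        exact le_sum_bump_pow_inv hN (m + d) hx

/-! ### Rational functions -/

/-- A quotient of polynomials can be reduced to one in lowest terms without raising the degree. -/
lemma exists_isRationalOfDegree {d n : ℕ} {P Q : MvPolynomial (Fin d) ℝ} (hP : P ≠ 0)
    (hQ : ∀ x : EuclideanSpace ℝ (Fin d), 0 < MvPolynomial.eval (fun i => x i) Q)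
    (hPn : P.totalDegree ≤ n) (hQn : Q.totalDegree ≤ n) :
    ∃ k ≤ n, IsRationalOfDegree (fun x : EuclideanSpace ℝ (Fin d) =>
      MvPolynomial.eval (fun i => x i) P / MvPolynomial.eval (fun i => x i) Q) k := by
  obtain ⟨P', Q', c, hrel, rfl, rfl⟩ := UniqueFactorizationMonoid.exists_reduced_factors P hP Q
  have hc : c ≠ 0 := left_ne_zero_of_mul hP
  have hP' : P' ≠ 0 := right_ne_zero_of_mul hP
  have hQ0 : c * Q' ≠ 0 := fun h => by simpa [h] using hQ 0
  have hQ' : Q' ≠ 0 := right_ne_zero_of_mul hQ0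
  rw [MvPolynomial.totalDegree_mul_of_isDomain hc hP'] at hPn
  rw [MvPolynomial.totalDegree_mul_of_isDomain hc hQ'] at hQn
  simp only [map_mul] at hQ
  have hcx : ∀ x : EuclideanSpace ℝ (Fin d), MvPolynomial.eval (fun i => x i) c ≠ 0 :=
    fun x => left_ne_zero_of_mul (hQ x).ne'
  have hQx : ∀ x : EuclideanSpace ℝ (Fin d), MvPolynomial.eval (fun i => x i) Q' ≠ 0 :=
    fun x => right_ne_zero_of_mul (hQ x).ne'
  -- the reduced denominator vanishes nowhere, hence has constant sign
  have hcont : Continuous fun x : EuclideanSpace ℝ (Fin d) =>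
      MvPolynomial.eval (fun i => x i) Q' :=
    (MvPolynomial.continuous_eval Q').comp (by fun_prop)
  have hsign : ∃ u : ℝ, u ≠ 0 ∧
      ∀ x : EuclideanSpace ℝ (Fin d), 0 < u * MvPolynomial.eval (fun i => x i) Q' := by
    rcases lt_or_gt_of_ne (hQx 0) with h0 | h0
    · refine ⟨-1, by norm_num, fun x => ?_⟩
      by_contra hx
      obtain ⟨y, hy⟩ := mem_range_of_exists_le_of_exists_ge hcont ⟨0, h0.le⟩
        ⟨x, show (0 : ℝ) ≤ _ by linarith⟩
      exact hQx y hy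
    · refine ⟨1, by norm_num, fun x => ?_⟩
      by_contra hx
      obtain ⟨y, hy⟩ := mem_range_of_exists_le_of_exists_ge hcont
        ⟨x, show _ ≤ (0 : ℝ) by linarith⟩ ⟨0, h0.le⟩
      exact hQx y hy
  obtain ⟨u, hu, hux⟩ := hsign
  have hCu : IsUnit (MvPolynomial.C u : MvPolynomial (Fin d) ℝ) := (IsUnit.mk0 u hu).map _
  have hdeg : ∀ F : MvPolynomial (Fin d) ℝ, (MvPolynomial.C u * F).totalDegree ≤ F.totalDegree :=
    fun F => (MvPolynomial.totalDegree_mul _ _).trans (by simp)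
  refine ⟨_, ?_, MvPolynomial.C u * P', MvPolynomial.C u * Q', mul_ne_zero hCu.ne_zero hP',
    fun x => by simpa using hux x, ?_, fun x => ?_, rfl⟩
  · exact max_le ((hdeg _).trans (by omega)) ((hdeg _).trans (by omega))
  · rw [isRelPrime_mul_unit_left_left hCu, isRelPrime_mul_unit_left_right hCu]
    exact fun k hk hk' => hrel hk hk'
  · simp only [map_mul, MvPolynomial.eval_C]
    rw [mul_div_mul_left _ _ (hcx x), mul_div_mul_left _ _ hu]

/-- A weighted mean of polynomials whose weights are inverses of positive polynomials is a
quotient of polynomials. -/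
lemma exists_quotient_eq_weightedMean {d D₁ D₂ : ℕ} {ι : Type*} [Fintype ι] [Nonempty ι]
    (q T : ι → MvPolynomial (Fin d) ℝ)
    (hq : ∀ a, ∀ x : EuclideanSpace ℝ (Fin d), 0 < MvPolynomial.eval (fun i => x i) (q a))
    (hqD : ∀ a, (q a).totalDegree ≤ D₁) (hTD : ∀ a, (T a).totalDegree ≤ D₂) :
    ∃ P Q : MvPolynomial (Fin d) ℝ,
      (∀ x : EuclideanSpace ℝ (Fin d), 0 < MvPolynomial.eval (fun i => x i) Q) ∧
      P.totalDegree ≤ Fintype.card ι * D₁ + D₂ ∧ Q.totalDegree ≤ Fintype.card ι * D₁ + D₂ ∧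
      ∀ x : EuclideanSpace ℝ (Fin d),
        MvPolynomial.eval (fun i => x i) P / MvPolynomial.eval (fun i => x i) Q =
        (∑ a, (MvPolynomial.eval (fun i => x i) (q a))⁻¹ * MvPolynomial.eval (fun i => x i) (T a)) /
          ∑ a, (MvPolynomial.eval (fun i => x i) (q a))⁻¹ := by
  classical
  set L : ι → MvPolynomial (Fin d) ℝ := fun a => ∏ b ∈ Finset.univ.erase a, q b with hL
  have hLx : ∀ (a : ι) (x : EuclideanSpace ℝ (Fin d)), MvPolynomial.eval (fun i => x i) (L a) =
      (∏ b, MvPolynomial.eval (fun i => x i) (q b)) *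
        (MvPolynomial.eval (fun i => x i) (q a))⁻¹ := by
    intro a x
    rw [hL, map_prod, ← Finset.mul_prod_erase _ _ (Finset.mem_univ a)]
    field_simp [(hq a x).ne']
  have hLdeg : ∀ a, (L a).totalDegree ≤ Fintype.card ι * D₁ := by
    intro a
    refine (MvPolynomial.totalDegree_finsetProd _ _).trans ?_
    refine (Finset.sum_le_card_nsmul _ _ D₁ fun b _ => hqD b).trans ?_
    rw [smul_eq_mul]
    gcongr
    exact Finset.card_le_univ _
  refine ⟨∑ a, L a * T a, ∑ a, L a, fun x => ?_, ?_, ?_, fun x => ?_⟩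
  · rw [map_sum]
    refine Finset.sum_pos (fun a _ => ?_) Finset.univ_nonempty
    rw [hL, map_prod]
    exact Finset.prod_pos fun b _ => hq b x
  · refine MvPolynomial.totalDegree_finsetSum_le fun a _ => ?_
    exact (MvPolynomial.totalDegree_mul _ _).trans (add_le_add (hLdeg a) (hTD a))
  · exact MvPolynomial.totalDegree_finsetSum_le fun a _ => (hLdeg a).trans (Nat.le_add_right _ _)
  · have hprod : ∏ b, MvPolynomial.eval (fun i => x i) (q b) ≠ 0 :=
      Finset.prod_ne_zero_iff.2 fun b _ => (hq b x).ne'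
    simp only [map_sum, map_mul, hLx, mul_assoc, ← Finset.mul_sum]
    rw [mul_div_mul_left _ _ hprod]

/-- In coordinates, the Taylor polynomial of degree `n` is a polynomial of total degree at most `n`. -/
lemma exists_mvPolynomial_taylorAt {d : ℕ} (f : EuclideanSpace ℝ (Fin d) → ℝ)
    (S : Set (EuclideanSpace ℝ (Fin d))) (n : ℕ) (a : EuclideanSpace ℝ (Fin d)) :
    ∃ T : MvPolynomial (Fin d) ℝ, T.totalDegree ≤ n ∧
      ∀ x : EuclideanSpace ℝ (Fin d), MvPolynomial.eval (fun i => x i) T = taylorAt f S n a x := by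
  have hX : ∀ j : Fin d, (MvPolynomial.X j - MvPolynomial.C (a j) :
      MvPolynomial (Fin d) ℝ).totalDegree ≤ 1 := fun j =>
    (MvPolynomial.totalDegree_sub_C_le _ _).trans (MvPolynomial.totalDegree_X j).le
  refine ⟨∑ k ∈ Finset.range (n + 1), ∑ l : Fin k → Fin d,
    MvPolynomial.C (iteratedFDerivWithin ℝ k f S a (fun j => EuclideanSpace.single (l j) 1) /
      (k.factorial : ℝ)) * ∏ j, (MvPolynomial.X (l j) - MvPolynomial.C (a (l j))), ?_, fun x => ?_⟩
  · refine MvPolynomial.totalDegree_finsetSum_le fun k hk =>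
      MvPolynomial.totalDegree_finsetSum_le fun l _ => ?_
    refine (MvPolynomial.totalDegree_mul _ _).trans ?_
    rw [MvPolynomial.totalDegree_C, zero_add]
    refine (MvPolynomial.totalDegree_finsetProd _ _).trans ?_
    refine (Finset.sum_le_card_nsmul _ _ 1 fun j _ => hX (l j)).trans ?_
    have := Finset.mem_range.1 hk
    simp; omega
  · simp only [map_sum, map_mul, map_prod, map_sub, MvPolynomial.eval_C, MvPolynomial.eval_X,
      taylorAt]
    refine Finset.sum_congr rfl fun k _ => ?_
    rw [multilinear_apply_eq_sum, Finset.sum_div]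
    refine Finset.sum_congr rfl fun l _ => ?_
    simp only [PiLp.sub_apply]
    ring

lemma exists_mvPolynomial_bump {d N : ℕ} (hN : 1 ≤ N) (a : Fin d → Fin (N + 1)) :
    ∃ q : MvPolynomial (Fin d) ℝ, q.totalDegree ≤ 2 ∧
      ∀ x : EuclideanSpace ℝ (Fin d), MvPolynomial.eval (fun i => x i) q = bump N a x := by
  refine ⟨MvPolynomial.C 1 + ∑ j, (MvPolynomial.C (N : ℝ) * MvPolynomial.X j -
    MvPolynomial.C ((a j : ℕ) : ℝ)) ^ 2, ?_, fun x => by simp [bump_eq hN]⟩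
  refine (MvPolynomial.totalDegree_add _ _).trans (max_le (by simp) ?_)
  refine MvPolynomial.totalDegree_finsetSum_le fun j _ => ?_
  refine (MvPolynomial.totalDegree_pow _ _).trans ?_
  have h1 : (MvPolynomial.C (N : ℝ) * MvPolynomial.X j -
      MvPolynomial.C ((a j : ℕ) : ℝ) : MvPolynomial (Fin d) ℝ).totalDegree ≤ 1 := by
    refine (MvPolynomial.totalDegree_sub_C_le _ _).trans ?_
    refine (MvPolynomial.totalDegree_mul _ _).trans ?_
    rw [MvPolynomial.totalDegree_C, MvPolynomial.totalDegree_X]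
  omega

/-! ### The approximation -/

/-- Adding a constant from `{0, η}` makes the numerator of a quotient nonzero; the result is then
reduced to lowest terms. -/
lemma exists_isRationalOfDegree_add_const {d n : ℕ} {P Q : MvPolynomial (Fin d) ℝ} {η : ℝ}
    (hη : 0 < η) (hQ : ∀ x : EuclideanSpace ℝ (Fin d), 0 < MvPolynomial.eval (fun i => x i) Q)
    (hPn : P.totalDegree ≤ n) (hQn : Q.totalDegree ≤ n) :
    ∃ t : ℝ, 0 ≤ t ∧ t ≤ η ∧ ∃ k ≤ n, IsRationalOfDegree (fun x : EuclideanSpace ℝ (Fin d) =>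
      MvPolynomial.eval (fun i => x i) P / MvPolynomial.eval (fun i => x i) Q + t) k := by
  have hQ0 : Q ≠ 0 := fun h => by simpa [h] using hQ 0
  obtain ⟨t, ht0, htη, hne⟩ : ∃ t : ℝ, 0 ≤ t ∧ t ≤ η ∧ P + MvPolynomial.C t * Q ≠ 0 := by
    by_cases hP : P = 0
    · refine ⟨η, hη.le, le_rfl, ?_⟩
      rw [hP, zero_add]
      exact mul_ne_zero (by simpa using hη.ne') hQ0
    · exact ⟨0, le_rfl, hη.le, by simpa using hP⟩
  have hdeg : (P + MvPolynomial.C t * Q).totalDegree ≤ n := by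
    refine (MvPolynomial.totalDegree_add _ _).trans (max_le hPn ?_)
    refine (MvPolynomial.totalDegree_mul _ _).trans ?_
    simpa using hQn
  obtain ⟨k, hk, hr⟩ := exists_isRationalOfDegree hne hQ hdeg hQn
  refine ⟨t, ht0, htη, k, hk, ?_⟩
  convert hr using 2 with x
  have := (hQ x).ne'
  simp only [map_add, map_mul, MvPolynomial.eval_C]
  field_simp

/-- The approximation of one component `f` at one scale `N`, with explicit constants. -/
lemma exists_rational_approx {d n m N : ℕ} {f : EuclideanSpace ℝ (Fin d) → ℝ} {K δ A : ℝ}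
    (hK : 0 ≤ K) (hδ : 0 ≤ δ) (hm : n + 1 + δ ≤ 2 * m)
    (hf : ContDiffOn ℝ (n + 1 : ℕ) f (cube d))
    (hH : ∀ x ∈ cube d, ∀ y ∈ cube d, ‖iteratedFDerivWithin ℝ (n + 1) f (cube d) x -
      iteratedFDerivWithin ℝ (n + 1) f (cube d) y‖ ≤ K * ‖x - y‖ ^ δ)
    (hA0 : 0 < A) (hA : ∀ (N : ℕ) (t : ℝ), ∑ k : Fin (N + 1), (1 + (t - (k : ℕ)) ^ 2)⁻¹ ≤ A)
    (hN : 1 ≤ N) :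
    ∃ g : EuclideanSpace ℝ (Fin d) → ℝ,
      (∃ k ≤ (N + 1) ^ d * (2 * (m + d)) + (n + 1), IsRationalOfDegree g k) ∧
      ∀ x ∈ cube d,
        |f x - g x| ≤ (K * (A ^ d * (1 + d) ^ (m + d)) * (1 + 2 * (m + d)) + 1) *
          (N : ℝ) ^ (-(n + δ)) ∧
        ∃ g' : EuclideanSpace ℝ (Fin d) →L[ℝ] ℝ,
          HasFDerivWithinAt (fun y => f y - g y) g' (cube d) x ∧
          ‖g'‖ ≤ (K * (A ^ d * (1 + d) ^ (m + d)) * (1 + 2 * (m + d)) + 1) *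
            (N : ℝ) ^ (-(n + δ)) := by
  have hN0 : (0 : ℝ) < N := by positivity
  choose T hTdeg hT using fun a : Fin d → Fin (N + 1) =>
    exists_mvPolynomial_taylorAt f (cube d) (n + 1) (node N a)
  choose q hqdeg hq using fun a : Fin d → Fin (N + 1) => exists_mvPolynomial_bump hN a
  have hbump : ∀ (a : Fin d → Fin (N + 1)) x, 0 < bump N a x :=
    fun a x => one_pos.trans_le (one_le_bump a x)
  obtain ⟨P, Q, hQ, hPdeg, hQdeg, hPQ⟩ := exists_quotient_eq_weightedMean
    (D₁ := 2 * (m + d)) (D₂ := n + 1) (fun a => q a ^ (m + d)) T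
    (fun a x => by rw [map_pow, hq]; exact pow_pos (hbump a x) _)
    (fun a => (MvPolynomial.totalDegree_pow _ _).trans (by
      rw [mul_comm]; exact Nat.mul_le_mul_right _ (hqdeg a)))
    hTdeg
  simp only [map_pow, hq, hT] at hPQ
  have hcard : Fintype.card (Fin d → Fin (N + 1)) = (N + 1) ^ d := by simp
  rw [hcard] at hPdeg hQdeg
  set η : ℝ := (N : ℝ) ^ (-(n + δ)) with hη
  have hη0 : 0 < η := Real.rpow_pos_of_pos hN0 _
  obtain ⟨t, ht0, htη, k, hk, hrat⟩ := exists_isRationalOfDegree_add_const hη0 hQ hPdeg hQdeg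
  simp only [hPQ] at hrat
  refine ⟨_, ⟨k, hk, hrat⟩, fun x hx => ?_⟩
  choose w' hw hw' using fun a : Fin d → Fin (N + 1) => hasFDerivAt_bump_pow_inv a (m + d) x
  have hest := fun a : Fin d → Fin (N + 1) => taylorAt_estimates (convex_cube d)
    (uniqueDiffOn_cube d) (cube_subset_closure_interior d) hf hK hδ hH (node_mem_cube a) hx
  choose g' hg' hg'le using fun a => (hest a).2
  set c₀ : ℝ := A ^ d * (1 + d) ^ (m + d) with hc₀
  have hc₀0 : 0 ≤ c₀ := by positivity
  have hNη : (N : ℝ) * (N : ℝ) ^ (-(n + 1 + δ)) = η := by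
    rw [hη, mul_comm, ← Real.rpow_add_one hN0.ne']
    congr 1
    ring
  have hle : (N : ℝ) ^ (-(n + 1 + δ)) ≤ η :=
    Real.rpow_le_rpow_of_exponent_le (by exact_mod_cast hN) (by linarith)
  -- the Taylor error at each node, averaged over the nodes
  have hmean : ∀ (τ : ℝ) (u : (Fin d → Fin (N + 1)) → ℝ), 0 ≤ τ → τ ≤ 2 * m →
      (∀ a, u a ≤ K * ‖x - node N a‖ ^ τ) →
      ∑ a, (bump N a x ^ (m + d))⁻¹ * u a ≤
        K * c₀ * (N : ℝ) ^ (-τ) * ∑ a : Fin d → Fin (N + 1), (bump N a x ^ (m + d))⁻¹ := by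
    intro τ u hτ0 hτ hu
    calc ∑ a, (bump N a x ^ (m + d))⁻¹ * u a
        ≤ ∑ a, K * ((bump N a x ^ (m + d))⁻¹ * ‖x - node N a‖ ^ τ) := by
          refine Finset.sum_le_sum fun a _ => ?_
          have := hbump a x
          rw [mul_left_comm]
          gcongr
          exact hu a
      _ ≤ K * (c₀ * (N : ℝ) ^ (-τ) *
            ∑ a : Fin d → Fin (N + 1), (bump N a x ^ (m + d))⁻¹) := by
          rw [← Finset.mul_sum]
          gcongr
          exact sum_weight_mul_norm_rpow_le hA hA0 hN hτ0 hτ hx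
      _ = _ := by ring
  obtain ⟨e0, G', hG', e1⟩ := weightedMean_estimates (B := ((m + d : ℕ) : ℝ) * N)
    (T := fun a y => taylorAt f (cube d) (n + 1) (node N a) y)
    (w := fun a y => (bump N a y ^ (m + d))⁻¹) (by positivity)
    (fun a y => inv_pos.2 (pow_pos (hbump a y) _)) (fun a => (hw a).hasFDerivWithinAt) hw' hg'
    (hmean (n + 1 + δ) (fun a => |f x - taylorAt f (cube d) (n + 1) (node N a) x|)
      (by positivity) hm (fun a => (hest a).1))
    (hmean (n + δ) (fun a => ‖g' a‖) (by positivity) (by linarith) hg'le)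
  have hKc : 0 ≤ K * c₀ := mul_nonneg hK hc₀0
  have hmd : (0 : ℝ) ≤ (m : ℝ) + d := by positivity
  constructor
  · have h1 : K * c₀ * (N : ℝ) ^ (-(n + 1 + δ)) ≤ K * c₀ * η := by gcongr
    have h2 : 0 ≤ K * c₀ * (2 * (m + d)) * η := by positivity
    rw [← sub_sub]
    refine (abs_sub _ _).trans ?_
    rw [abs_of_nonneg ht0]
    nlinarith
  · refine ⟨G', ?_, e1.trans ?_⟩
    · simpa only [← sub_sub] using hG'.sub_const t
    · rw [← hη]
      have h3 : 2 * (((m + d : ℕ) : ℝ) * N) * (K * c₀ * (N : ℝ) ^ (-(n + 1 + δ))) =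
          2 * (m + d) * (K * c₀) * (N * (N : ℝ) ^ (-(n + 1 + δ))) := by
        push_cast
        ring
      rw [h3, hNη]
      nlinarith

end RatApprox

theorem corollary3p3 (d p : ℕ) (hd : 1 ≤ d) (hp : 1 ≤ p) (β : ℝ) (hβ : 2 < β)
    (H : ℝ) (hH : 0 < H) (f : EuclideanSpace ℝ (Fin d) → EuclideanSpace ℝ (Fin p))
    (hf : f ∈ RatApprox.holderBall d p β H) (ε : ℝ) (hε : 0 < ε) :
    ∃ c : ℝ, 0 < c ∧ ∃ C : ℝ, 0 < C ∧
      ∃ R : ℕ → EuclideanSpace ℝ (Fin d) → EuclideanSpace ℝ (Fin p), ∀ N : ℕ, 1 ≤ N →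
        (∀ i : Fin p, ∃ n : ℕ, RatApprox.IsRationalOfDegree (fun x => R N x i) n ∧
          (n : ℝ) ≤ C * (N : ℝ) ^ ((d : ℝ) + ε)) ∧
        RatApprox.ckNorm 1 (fun x => f x - R N x) ≤
          ENNReal.ofReal (c * (N : ℝ) ^ (-(β - 1))) := by
  obtain ⟨A, hA0, hA⟩ := RatApprox.exists_sum_inv_one_add_sq_le
  obtain ⟨n, hn⟩ : ∃ n, ⌊β⌋₊ = n + 1 :=
    Nat.exists_eq_succ_of_ne_zero (Nat.floor_pos.2 (by linarith)).ne'
  -- the smoothness and the Hölder condition, with the order written as `n + 1`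
  have hcd := fun i => RatApprox.contDiffOn_apply hf i
  have hho := fun i x hx y hy => RatApprox.norm_iteratedFDerivWithin_sub_le (by linarith) hH.le hf i
    (x := x) (y := y) hx hy
  have hδ : 0 ≤ β - ⌊β⌋₊ := sub_nonneg.2 (Nat.floor_le (by linarith))
  have hβn := Nat.lt_floor_add_one β
  rw [hn] at hcd hho hδ hβn
  set K : ℝ := (d : ℝ) ^ (n + 1) * H
  have hK : 0 ≤ K := by positivity
  have hkey : ∀ (N : ℕ) (i : Fin p), ∃ g : EuclideanSpace ℝ (Fin d) → ℝ, 1 ≤ N → _ :=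
    fun N i => by
      by_cases hN : 1 ≤ N
      · obtain ⟨g, hg⟩ := RatApprox.exists_rational_approx (m := n + 2) hK hδ
          (by push_cast at hβn ⊢; linarith) (hcd i) (hho i) hA0 hA hN
        exact ⟨g, fun _ => hg⟩
      · exact ⟨0, fun h => absurd h hN⟩
  choose g hg using hkey
  refine ⟨K * (A ^ d * (1 + d) ^ (n + 2 + d)) * (1 + 2 * ((n + 2 : ℕ) + d)) + 1, by positivity,
    2 ^ d * (2 * (n + 2 + d)) + (n + 1), by positivity,
    fun N x => WithLp.toLp 2 fun i => g N i x, fun N hN => ⟨fun i => ?_, ?_⟩⟩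
  · obtain ⟨⟨k, hk, hrat⟩, -⟩ := hg N i hN
    refine ⟨k, hrat, ?_⟩
    have hN1 : (1 : ℝ) ≤ N := by exact_mod_cast hN
    have hpow : (N : ℝ) ^ d ≤ (N : ℝ) ^ ((d : ℝ) + ε) := by
      rw [← Real.rpow_natCast]
      exact Real.rpow_le_rpow_of_exponent_le hN1 (by linarith)
    have hone : (1 : ℝ) ≤ (N : ℝ) ^ ((d : ℝ) + ε) := Real.one_le_rpow hN1 (by positivity)
    have hk' : (k : ℝ) ≤ ((N : ℝ) + 1) ^ d * (2 * (n + 2 + d)) + (n + 1) := by exact_mod_cast hk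
    calc (k : ℝ) ≤ (2 * (N : ℝ)) ^ d * (2 * (n + 2 + d)) + (n + 1) * 1 := by
          rw [mul_one]
          refine hk'.trans ?_
          gcongr
          linarith
      _ = 2 ^ d * (2 * (n + 2 + d)) * (N : ℝ) ^ d + (n + 1) * 1 := by
          rw [mul_pow]
          ring
      _ ≤ 2 ^ d * (2 * (n + 2 + d)) * (N : ℝ) ^ ((d : ℝ) + ε) +
            (n + 1) * (N : ℝ) ^ ((d : ℝ) + ε) := by gcongr
      _ = _ := by ring
  · refine RatApprox.ckNorm_one_le fun i x hx => ?_
    have h := (hg N i hN).2 x hx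
    rw [show -((n : ℝ) + (β - ((n + 1 : ℕ) : ℝ))) = -(β - 1) by push_cast; ring] at h
    exact h
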